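/- **Theorem.** Let $p,q\ge 1$ be integers and let $M$ be a smooth manifold of dimension $2p+2q+2$ with a Riemannian metric $g$ and a normal metric contact pair structure $(\alpha_1,\alpha_2,Z_1,Z_2,\phi,g)$ of type $(p,q)$ with decomposable $\phi$. That is: - $\alpha_1,\alpha_2$ are smooth 1-forms such that $\alpha_1\wedge(d\alpha_1)^p\wedge\alpha_2\wedge(d\alpha_2)^q$ vanishes nowhere, $(d\alpha_1)^{p+1}=0$ and $(d\alpha_2)^{q+1}=0$; here $d\alpha(X,Y)=\tfrac12\big(X(\alpha(Y))-Y(\alpha(X))-\alpha([X,Y])\big)$; - $Z_1,Z_2$ are the Reeb vector fields: $\alpha_i(Z_j)=\delta_{ij}$ and $i_{Z_i}d\alpha_j=0$ for $i,j\in\{1,2\}$; - $\phi$ is a $(1,1)$-tensor field with $\phi^2=-I+\alpha_1\otimes Z_1+\alpha_2\otimes Z_2$ and $\phi Z_1=\phi Z_2=0$, and $\phi$ is decomposable: it preserves $\ker\alpha_i\cap\ker d\alpha_i$ for $i=1,2$; - $g$ is compatible with and associated to the structure: $g(\phi X,\phi Y)=g(X,Y)-\alpha_1(X)\alpha_1(Y)-\alpha_2(X)\alpha_2(Y)$,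 $g(X,\phi Y)=(d\alpha_1+d\alpha_2)(X,Y)$ and $g(X,Z_i)=\alpha_i(X)$; - (normality) the almost complex structures $J=\phi-\alpha_2\otimes Z_1+\alpha_1\otimes Z_2$ and $T=\phi+\alpha_2\otimes Z_1-\alpha_1\otimes Z_2$ are integrable, i.e. their Nijenhuis tensors vanish. Suppose that $M$ is generalized quasi-Einstein: there are functions $\lambda,\beta,\mu$ on $M$, with $\beta$ and $\mu$ not both identically zero, such that $$\mathrm{Ric}(X,Y)=\lambda\, g(X,Y)+\beta\,\alpha_1(X)\alpha_1(Y)+\mu\,\alpha_2(X)\alpha_2(Y)$$ for all vector fields $X,Y$. Then the Ricci tensor of $M$ is not of Codazzi type: with $\nabla$ the Levi-Civita connection of $g$, it is not true that $(\nabla_X\mathrm{Ric})(Y,W)=(\nabla_Y\mathrm{Ric})(X,W)$ for all smooth vector fields $X,Y,W$ on $M$. -/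

import Mathlib

set_option linter.unusedSectionVars false

open Bundle VectorField
open scoped Manifold ContDiff

noncomputable section

namespace ContactPairs

/-! ### The Levi-Civita connection -/

section LeviCivita

variable {E : Type*} [NormedAddCommGroup E] [NormedSpace ℝ E] [FiniteDimensional ℝ E]
  {H : Type*} [TopologicalSpace H] {I : ModelWithCorners ℝ E H}
  {M : Type*} [TopologicalSpace M] [ChartedSpace H M] [IsManifold I ∞ M]
  [RiemannianBundle (fun x : M => TangentSpace I x)]
  [IsContMDiffRiemannianBundle I ∞ E (fun x : M => TangentSpace I x)]

instance tangentSpace_finiteDimensional (I : ModelWithCorners ℝ E H) (x : M) : FiniteDimensional ℝ (TangentSpace I x) :=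
  inferInstanceAs (FiniteDimensional ℝ E)

theorem mdifferentiableAt_inner {X Y : Π x : M, TangentSpace I x} {x : M}
    (hX : MDiffAt (T% X) x) (hY : MDiffAt (T% Y) x) :
    MDiffAt (fun y => (inner ℝ (X y) (Y y) : ℝ)) x :=
  MDifferentiableAt.inner_bundle (IB := I) (F := E) (E := fun x : M => TangentSpace I x) hX hY

variable (I) in
/-- `g(∇_X Y, Z)` at `x`, as given by the Koszul formula. -/
def koszul (X Y Z : Π x : M, TangentSpace I x) (x : M) : ℝ :=
  (1 / 2) *
    (mvfderiv I (fun y => inner ℝ (Y y) (Z y)) x (X x)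
      + mvfderiv I (fun y => inner ℝ (X y) (Z y)) x (Y x)
      - mvfderiv I (fun y => inner ℝ (X y) (Y y)) x (Z x)
      + inner ℝ (mlieBracket I X Y x) (Z x)
      - inner ℝ (mlieBracket I X Z x) (Y x)
      - inner ℝ (mlieBracket I Y Z x) (X x))

theorem koszul_tensorial₁ {Y Z : Π x : M, TangentSpace I x} {x : M}
    (hY : MDiffAt (T% Y) x) (hZ : MDiffAt (T% Z) x) :
    TensorialAt I E (fun X => koszul I X Y Z x) x where
  smul {f X} hf hX := by
    have h1 : mvfderiv I (fun y => inner ℝ ((f • X) y) (Z y)) x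
        = f x • mvfderiv I (fun y => inner ℝ (X y) (Z y)) x
          + inner ℝ (X x) (Z x) • mvfderiv I f x := by
      rw [← mvfderiv_fun_mul hf (mdifferentiableAt_inner hX hZ)]
      congr 1; ext y; simp [inner_smul_left]
    have h2 : mvfderiv I (fun y => inner ℝ ((f • X) y) (Y y)) x
        = f x • mvfderiv I (fun y => inner ℝ (X y) (Y y)) x
          + inner ℝ (X x) (Y x) • mvfderiv I f x := by
      rw [← mvfderiv_fun_mul hf (mdifferentiableAt_inner hX hY)]
      congr 1; ext y; simp [inner_smul_left]
    simp only [koszul, h1, h2, mlieBracket_smul_left hf hX]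
    simp [inner_add_left, inner_smul_left, inner_smul_right]
    ring
  add {X X'} hX hX' := by
    have h1 : mvfderiv I (fun y => inner ℝ ((X + X') y) (Z y)) x
        = mvfderiv I (fun y => inner ℝ (X y) (Z y)) x
          + mvfderiv I (fun y => inner ℝ (X' y) (Z y)) x := by
      rw [← mvfderiv_fun_add (mdifferentiableAt_inner hX hZ) (mdifferentiableAt_inner hX' hZ)]
      congr 1; ext y; simp [inner_add_left]
    have h2 : mvfderiv I (fun y => inner ℝ ((X + X') y) (Y y)) x
        = mvfderiv I (fun y => inner ℝ (X y) (Y y)) x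
          + mvfderiv I (fun y => inner ℝ (X' y) (Y y)) x := by
      rw [← mvfderiv_fun_add (mdifferentiableAt_inner hX hY) (mdifferentiableAt_inner hX' hY)]
      congr 1; ext y; simp [inner_add_left]
    simp only [koszul, h1, h2, mlieBracket_add_left hX hX']
    simp [inner_add_left, inner_add_right]
    ring

theorem koszul_tensorial₂ {X Y : Π x : M, TangentSpace I x} {x : M}
    (hX : MDiffAt (T% X) x) (hY : MDiffAt (T% Y) x) :
    TensorialAt I E (fun Z => koszul I X Y Z x) x where
  smul {f Z} hf hZ := by
    have h1 : mvfderiv I (fun y => inner ℝ (Y y) ((f • Z) y)) x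
        = f x • mvfderiv I (fun y => inner ℝ (Y y) (Z y)) x
          + inner ℝ (Y x) (Z x) • mvfderiv I f x := by
      rw [← mvfderiv_fun_mul hf (mdifferentiableAt_inner hY hZ)]
      congr 1; ext y; simp [inner_smul_right]
    have h2 : mvfderiv I (fun y => inner ℝ (X y) ((f • Z) y)) x
        = f x • mvfderiv I (fun y => inner ℝ (X y) (Z y)) x
          + inner ℝ (X x) (Z x) • mvfderiv I f x := by
      rw [← mvfderiv_fun_mul hf (mdifferentiableAt_inner hX hZ)]
      congr 1; ext y; simp [inner_smul_right]
    simp only [koszul, h1, h2, mlieBracket_smul_right hf hZ]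
    simp [inner_add_left, inner_smul_left, inner_smul_right]
    rw [real_inner_comm (Y x) (Z x), real_inner_comm (X x) (Z x)]
    ring
  add {Z Z'} hZ hZ' := by
    have h1 : mvfderiv I (fun y => inner ℝ (Y y) ((Z + Z') y)) x
        = mvfderiv I (fun y => inner ℝ (Y y) (Z y)) x
          + mvfderiv I (fun y => inner ℝ (Y y) (Z' y)) x := by
      rw [← mvfderiv_fun_add (mdifferentiableAt_inner hY hZ) (mdifferentiableAt_inner hY hZ')]
      congr 1; ext y; simp [inner_add_right]
    have h2 : mvfderiv I (fun y => inner ℝ (X y) ((Z + Z') y)) x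
        = mvfderiv I (fun y => inner ℝ (X y) (Z y)) x
          + mvfderiv I (fun y => inner ℝ (X y) (Z' y)) x := by
      rw [← mvfderiv_fun_add (mdifferentiableAt_inner hX hZ) (mdifferentiableAt_inner hX hZ')]
      congr 1; ext y; simp [inner_add_right]
    simp only [koszul, h1, h2, mlieBracket_add_right hZ hZ']
    simp [inner_add_left, inner_add_right]
    ring

theorem koszul_add {X Y Y' Z : Π x : M, TangentSpace I x} {x : M} (hX : MDiffAt (T% X) x)
    (hY : MDiffAt (T% Y) x) (hY' : MDiffAt (T% Y') x) (hZ : MDiffAt (T% Z) x) :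
    koszul I X (Y + Y') Z x = koszul I X Y Z x + koszul I X Y' Z x := by
  have h1 : mvfderiv I (fun y => inner ℝ ((Y + Y') y) (Z y)) x
      = mvfderiv I (fun y => inner ℝ (Y y) (Z y)) x
        + mvfderiv I (fun y => inner ℝ (Y' y) (Z y)) x := by
    rw [← mvfderiv_fun_add (mdifferentiableAt_inner hY hZ) (mdifferentiableAt_inner hY' hZ)]
    congr 1; ext y; simp [inner_add_left]
  have h2 : mvfderiv I (fun y => inner ℝ (X y) ((Y + Y') y)) x
      = mvfderiv I (fun y => inner ℝ (X y) (Y y)) x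
        + mvfderiv I (fun y => inner ℝ (X y) (Y' y)) x := by
    rw [← mvfderiv_fun_add (mdifferentiableAt_inner hX hY) (mdifferentiableAt_inner hX hY')]
    congr 1; ext y; simp [inner_add_right]
  simp only [koszul, h1, h2, mlieBracket_add_right hY hY', mlieBracket_add_left hY hY']
  simp [inner_add_left, inner_add_right]
  ring

theorem koszul_smul {f : M → ℝ} {X Y Z : Π x : M, TangentSpace I x} {x : M}
    (hf : MDiffAt f x) (hX : MDiffAt (T% X) x)
    (hY : MDiffAt (T% Y) x) (hZ : MDiffAt (T% Z) x) :
    koszul I X (f • Y) Z x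
      = f x * koszul I X Y Z x + mvfderiv I f x (X x) * inner ℝ (Y x) (Z x) := by
  have h1 : mvfderiv I (fun y => inner ℝ ((f • Y) y) (Z y)) x
      = f x • mvfderiv I (fun y => inner ℝ (Y y) (Z y)) x
        + inner ℝ (Y x) (Z x) • mvfderiv I f x := by
    rw [← mvfderiv_fun_mul hf (mdifferentiableAt_inner hY hZ)]
    congr 1; ext y; simp [inner_smul_left]
  have h2 : mvfderiv I (fun y => inner ℝ (X y) ((f • Y) y)) x
      = f x • mvfderiv I (fun y => inner ℝ (X y) (Y y)) x
        + inner ℝ (X x) (Y x) • mvfderiv I f x := by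
    rw [← mvfderiv_fun_mul hf (mdifferentiableAt_inner hX hY)]
    congr 1; ext y; simp [inner_smul_right]
  simp only [koszul, h1, h2, mlieBracket_smul_right hf hY, mlieBracket_smul_left hf hY]
  simp [inner_add_left, inner_smul_left, inner_smul_right]
  rw [real_inner_comm (X x) (Y x)]
  ring

variable (I) in
open Classical in
/-- The Levi-Civita connection as a function: where `Y` is differentiable, `v ↦ ∇_v Y` is the
endomorphism of `T_xM` with `g(∇_v Y, w)` given by the Koszul formula. -/
def leviCivitaFun (Y : Π x : M, TangentSpace I x) (x : M) :
    TangentSpace I x →L[ℝ] TangentSpace I x :=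
  if hY : MDiffAt (T% Y) x then
    let B : TangentSpace I x →L[ℝ] TangentSpace I x →L[ℝ] ℝ :=
      TensorialAt.mkHom₂ (I := I) (F := E) (F' := E) (fun X Z => koszul I X Y Z x) x
        (fun _ hZ => koszul_tensorial₁ hY hZ) (fun _ hX => koszul_tensorial₂ hX hY)
    let e := stdOrthonormalBasis ℝ (TangentSpace I x)
    ∑ i, (B.flip (e i)).smulRight (e i)
  else 0

theorem inner_leviCivitaFun {X Y Z : Π x : M, TangentSpace I x} {x : M}
    (hX : MDiffAt (T% X) x) (hY : MDiffAt (T% Y) x) (hZ : MDiffAt (T% Z) x) :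
    inner ℝ (leviCivitaFun I Y x (X x)) (Z x) = koszul I X Y Z x := by
  set B : TangentSpace I x →L[ℝ] TangentSpace I x →L[ℝ] ℝ :=
      TensorialAt.mkHom₂ (I := I) (F := E) (F' := E) (fun X Z => koszul I X Y Z x) x
        (fun _ hZ => koszul_tensorial₁ hY hZ) (fun _ hX => koszul_tensorial₂ hX hY) with hB
  have key : B (X x) (Z x) = koszul I X Y Z x :=
    TensorialAt.mkHom₂_apply (I := I) (F := E) (F' := E)
      (fun _ hZ => koszul_tensorial₁ hY hZ) (fun _ hX => koszul_tensorial₂ hX hY) hX hZ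
  rw [← key, leviCivitaFun, dif_pos hY]
  set e := stdOrthonormalBasis ℝ (TangentSpace I x)
  conv_rhs => rw [← e.sum_repr' (Z x)]
  simp [sum_inner, inner_smul_left, ← hB, mul_comm]

theorem leviCivitaFun_ext {x : M} {u v : TangentSpace I x}
    (h : ∀ Z : Π x : M, TangentSpace I x, MDiffAt (T% Z) x → inner ℝ u (Z x) = inner ℝ v (Z x)) :
    u = v := by
  refine ext_inner_right ℝ fun w => ?_
  simpa using h (FiberBundle.extend E w) (FiberBundle.mdifferentiableAt_extend ..)

variable (I M) in
/-- The Levi-Civita connection of the Riemannian manifold `M`. -/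
def leviCivita : CovariantDerivative I E (fun x : M => TangentSpace I x) where
  toFun := leviCivitaFun I
  isCovariantDerivativeOnUniv := {
    add := by
      intro Y Y' x hY hY' _
      ext1 v
      refine leviCivitaFun_ext fun Z hZ => ?_
      have hX : MDiffAt (T% (FiberBundle.extend E v : Π x : M, TangentSpace I x)) x :=
        FiberBundle.mdifferentiableAt_extend ..
      have e1 := inner_leviCivitaFun hX hY hZ
      have e2 := inner_leviCivitaFun hX hY' hZ
      have e3 := inner_leviCivitaFun hX (mdifferentiableAt_add_section hY hY') hZ
      rw [FiberBundle.extend_apply_self] at e1 e2 e3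
      rw [_root_.add_apply, inner_add_left, e1, e2, ← koszul_add hX hY hY' hZ]
      exact e3
    leibniz := by
      intro Y f x hY hf _
      ext1 v
      refine leviCivitaFun_ext fun Z hZ => ?_
      have hX : MDiffAt (T% (FiberBundle.extend E v : Π x : M, TangentSpace I x)) x :=
        FiberBundle.mdifferentiableAt_extend ..
      have e1 := inner_leviCivitaFun hX hY hZ
      have e3 := inner_leviCivitaFun hX (hf.smul_section hY) hZ
      have e4 := koszul_smul hf hX hY hZ
      rw [FiberBundle.extend_apply_self] at e1 e3 e4
      simp only [_root_.add_apply, inner_add_left, _root_.smul_apply,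
        ContinuousLinearMap.smulRight_apply, inner_smul_left, e1]
      simp only [conj_trivial]
      rw [← e4]
      exact e3 }

theorem inner_leviCivita {X Y Z : Π x : M, TangentSpace I x} {x : M}
    (hX : MDiffAt (T% X) x) (hY : MDiffAt (T% Y) x) (hZ : MDiffAt (T% Z) x) :
    inner ℝ (leviCivita I M Y x (X x)) (Z x) = koszul I X Y Z x :=
  inner_leviCivitaFun hX hY hZ

theorem leviCivita_metric {X Y Z : Π x : M, TangentSpace I x} {x : M}
    (hX : MDiffAt (T% X) x) (hY : MDiffAt (T% Y) x) (hZ : MDiffAt (T% Z) x) :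
    mvfderiv I (fun y => inner ℝ (Y y) (Z y)) x (X x)
      = inner ℝ (leviCivita I M Y x (X x)) (Z x) + inner ℝ (Y x) (leviCivita I M Z x (X x)) := by
  rw [real_inner_comm (leviCivita I M Z x (X x)) (Y x), inner_leviCivita hX hY hZ,
    inner_leviCivita hX hZ hY]
  have h : (fun y => (inner ℝ (Z y) (Y y) : ℝ)) = fun y => inner ℝ (Y y) (Z y) := by
    ext y; exact real_inner_comm _ _
  simp only [koszul, h, mlieBracket_swap_apply (V := Z) (W := Y), inner_neg_left]
  ring

theorem leviCivita_torsion {X Y : Π x : M, TangentSpace I x} {x : M}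
    (hX : MDiffAt (T% X) x) (hY : MDiffAt (T% Y) x) :
    leviCivita I M Y x (X x) - leviCivita I M X x (Y x) = mlieBracket I X Y x := by
  refine leviCivitaFun_ext fun Z hZ => ?_
  rw [inner_sub_left, inner_leviCivita hX hY hZ, inner_leviCivita hY hX hZ]
  have h : (fun y => (inner ℝ (Y y) (X y) : ℝ)) = fun y => inner ℝ (X y) (Y y) := by
    ext y; exact real_inner_comm _ _
  simp only [koszul, h, mlieBracket_swap_apply (V := Y) (W := X), inner_neg_left]
  ring

end LeviCivita

/-! ### Ricci curvature and its covariant derivative -/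

section Curvature

variable {E : Type*} [NormedAddCommGroup E] [NormedSpace ℝ E] [FiniteDimensional ℝ E]
  {H : Type*} [TopologicalSpace H] (I : ModelWithCorners ℝ E H)
  {M : Type*} [TopologicalSpace M] [ChartedSpace H M] [IsManifold I ∞ M]
  [RiemannianBundle (fun x : M => TangentSpace I x)]
  [IsContMDiffRiemannianBundle I ∞ E (fun x : M => TangentSpace I x)]

/-- The vector field `∇_X Y`. -/
def nabla (X Y : Π x : M, TangentSpace I x) (x : M) : TangentSpace I x :=
  leviCivita I M Y x (X x)

/-- `R(X, Y)W = ∇_X ∇_Y W - ∇_Y ∇_X W - ∇_[X,Y] W`. -/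
def curvature (X Y W : Π x : M, TangentSpace I x) (x : M) : TangentSpace I x :=
  nabla I X (nabla I Y W) x - nabla I Y (nabla I X W) x - nabla I (mlieBracket I X Y) W x

/-- The Ricci tensor: `Ric(v, w)` is the trace of `u ↦ R(u, v)w`, computed in an orthonormal basis
of `T_xM`; `FiberBundle.extend` extends a tangent vector at `x` to a vector field that is smooth
near `x`. -/
def ricci (x : M) (v w : TangentSpace I x) : ℝ :=
  let e := stdOrthonormalBasis ℝ (TangentSpace I x)
  ∑ i, inner ℝ
    (curvature I (FiberBundle.extend E (e i)) (FiberBundle.extend E v) (FiberBundle.extend E w) x)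
    (e i)

/-- `(∇_X Ric)(Y, W) = X(Ric(Y, W)) - Ric(∇_X Y, W) - Ric(Y, ∇_X W)`. -/
def nablaRicci (X Y W : Π x : M, TangentSpace I x) (x : M) : ℝ :=
  mvfderiv I (fun y => ricci I y (Y y) (W y)) x (X x)
    - ricci I x (nabla I X Y x) (W x) - ricci I x (Y x) (nabla I X W x)

variable (M) in
/-- The Ricci tensor is of Codazzi type: `(∇_X Ric)(Y, W) = (∇_Y Ric)(X, W)` for all smooth vector
fields `X`, `Y`, `W`. -/
def RicciIsCodazzi : Prop :=
  ∀ X Y W : Π x : M, TangentSpace I x,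
    CMDiff ∞ (T% X) → CMDiff ∞ (T% Y) → CMDiff ∞ (T% W) →
      ∀ x, nablaRicci I X Y W x - nablaRicci I Y X W x = 0

end Curvature

/-! ### Exterior algebra -/

section Exterior

variable {V : Type*} [AddCommGroup V] [Module ℝ V]

/-- The exterior product of alternating forms. -/
def wedge {k l : ℕ} (a : V [⋀^Fin k]→ₗ[ℝ] ℝ) (b : V [⋀^Fin l]→ₗ[ℝ] ℝ) :
    V [⋀^Fin (k + l)]→ₗ[ℝ] ℝ :=
  ((LinearMap.mul' ℝ ℝ).compAlternatingMap (a.domCoprod b)).domDomCongr finSumFinEquiv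

/-- The exterior power `η ∧ ⋯ ∧ η` (`n` factors) of a 2-form. -/
def wedgePow (η : V [⋀^Fin 2]→ₗ[ℝ] ℝ) : (n : ℕ) → V [⋀^Fin (2 * n)]→ₗ[ℝ] ℝ
  | 0 => (AlternatingMap.constOfIsEmpty ℝ V (Fin 0) 1 : V [⋀^Fin 0]→ₗ[ℝ] ℝ)
  | n + 1 => wedge (wedgePow η n) η

/-- A linear form, as an alternating form of degree 1. -/
def formOne (a : V →ₗ[ℝ] ℝ) : V [⋀^Fin 1]→ₗ[ℝ] ℝ :=
  AlternatingMap.ofSubsingleton ℝ V ℝ (0 : Fin 1) a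

/-- An alternating bilinear form, as an alternating form of degree 2. -/
def formTwo (B : V →ₗ[ℝ] V →ₗ[ℝ] ℝ) (hB : ∀ v, B v v = 0) : V [⋀^Fin 2]→ₗ[ℝ] ℝ where
  toFun v := B (v 0) (v 1)
  map_update_add' := by
    intro _ m i x y
    fin_cases i <;> simp [Function.update]
  map_update_smul' := by
    intro _ m i c x
    fin_cases i <;> simp [Function.update]
  map_eq_zero_of_eq' := by
    intro v i j hij hne
    fin_cases i <;> fin_cases j <;> simp_all

end Exterior

/-! ### Tensor fields and the exterior derivative of a 1-form -/

section Forms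

variable {E : Type*} [NormedAddCommGroup E] [NormedSpace ℝ E] [FiniteDimensional ℝ E]
  {H : Type*} [TopologicalSpace H] (I : ModelWithCorners ℝ E H)
  (M : Type*) [TopologicalSpace M] [ChartedSpace H M] [IsManifold I ∞ M]

/-- A smooth vector field. -/
structure SmoothVectorField where
  toFun : Π x : M, TangentSpace I x
  smooth : CMDiff ∞ (T% toFun)

/-- A smooth 1-form. -/
structure SmoothOneForm where
  toFun : Π x : M, TangentSpace I x →L[ℝ] ℝ
  smooth : ContMDiff I (I.prod 𝓘(ℝ, E →L[ℝ] ℝ)) ∞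
    (fun x => TotalSpace.mk' (E →L[ℝ] ℝ) (E := fun x => TangentSpace I x →L[ℝ] ℝ) x (toFun x))

/-- A smooth tensor field of type `(1, 1)`. -/
structure SmoothEndField where
  toFun : Π x : M, TangentSpace I x →L[ℝ] TangentSpace I x
  smooth : ContMDiff I (I.prod 𝓘(ℝ, E →L[ℝ] E)) ∞
    (fun x => TotalSpace.mk' (E →L[ℝ] E)
      (E := fun x => TangentSpace I x →L[ℝ] TangentSpace I x) x (toFun x))

variable {I M}

instance : CoeFun (SmoothVectorField I M) (fun _ => Π x : M, TangentSpace I x) :=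
  ⟨SmoothVectorField.toFun⟩

instance : CoeFun (SmoothOneForm I M) (fun _ => Π x : M, TangentSpace I x →L[ℝ] ℝ) :=
  ⟨SmoothOneForm.toFun⟩

instance : CoeFun (SmoothEndField I M)
    (fun _ => Π x : M, TangentSpace I x →L[ℝ] TangentSpace I x) :=
  ⟨SmoothEndField.toFun⟩

namespace SmoothOneForm

theorem mdifferentiableAt_apply (α : SmoothOneForm I M) {X : Π x : M, TangentSpace I x} {x : M}
    (hX : MDiffAt (T% X) x) : MDiffAt (fun y => α y (X y)) x := by
  have h : MDifferentiableAt I (I.prod 𝓘(ℝ))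
      (fun y => TotalSpace.mk' ℝ (E := Bundle.Trivial M ℝ) y (α y (X y))) x := by
    apply MDifferentiableAt.clm_bundle_apply (F₁ := E) (F₂ := ℝ) (b := fun y : M => y)
      (E₁ := fun y : M => TangentSpace I y) (E₂ := Bundle.Trivial M ℝ)
    · exact (α.smooth x).mdifferentiableAt (by simp)
    · exact hX
  simpa [mdifferentiableAt_section] using h

/-- `dα(X, Y) = ½ (X(α(Y)) - Y(α(X)) - α([X, Y]))`. -/
def extDerivAux (α : SmoothOneForm I M) (X Y : Π x : M, TangentSpace I x) (x : M) : ℝ :=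
  (1 / 2) * (mvfderiv I (fun y => α y (Y y)) x (X x) - mvfderiv I (fun y => α y (X y)) x (Y x)
    - α x (mlieBracket I X Y x))

theorem extDerivAux_swap (α : SmoothOneForm I M) (X Y : Π x : M, TangentSpace I x) (x : M) :
    α.extDerivAux X Y x = - α.extDerivAux Y X x := by
  simp only [extDerivAux, mlieBracket_swap_apply (V := Y) (W := X), map_neg]
  ring

theorem extDerivAux_tensorial₂ (α : SmoothOneForm I M) (X : Π x : M, TangentSpace I x) {x : M} :
    TensorialAt I E (fun Y => α.extDerivAux X Y x) x where
  smul {f Y} hf hY := by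
    have h1 : mvfderiv I (fun y => α y ((f • Y) y)) x
        = f x • mvfderiv I (fun y => α y (Y y)) x + α x (Y x) • mvfderiv I f x := by
      rw [← mvfderiv_fun_mul hf (α.mdifferentiableAt_apply hY)]
      congr 1; ext y; simp
    simp only [extDerivAux, h1, mlieBracket_smul_right hf hY]
    simp
    ring
  add {Y Y'} hY hY' := by
    have h1 : mvfderiv I (fun y => α y ((Y + Y') y)) x
        = mvfderiv I (fun y => α y (Y y)) x + mvfderiv I (fun y => α y (Y' y)) x := by
      rw [← mvfderiv_fun_add (α.mdifferentiableAt_apply hY) (α.mdifferentiableAt_apply hY')]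
      congr 1; ext y; simp
    simp only [extDerivAux, h1, mlieBracket_add_right hY hY']
    simp
    ring

theorem extDerivAux_tensorial₁ (α : SmoothOneForm I M) (Y : Π x : M, TangentSpace I x) {x : M} :
    TensorialAt I E (fun X => α.extDerivAux X Y x) x where
  smul {f X} hf hX := by
    have h := (α.extDerivAux_tensorial₂ Y).smul hf hX
    simp only [α.extDerivAux_swap _ Y] at h ⊢
    rw [h, smul_neg]
  add {X X'} hX hX' := by
    have h := (α.extDerivAux_tensorial₂ Y).add hX hX'
    simp only [α.extDerivAux_swap _ Y] at h ⊢
    rw [h, neg_add]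

/-- The exterior derivative `dα` of a 1-form, with the normalization
`dα(X, Y) = ½ (X(α(Y)) - Y(α(X)) - α([X, Y]))`. -/
def extDeriv (α : SmoothOneForm I M) (x : M) :
    TangentSpace I x →L[ℝ] TangentSpace I x →L[ℝ] ℝ :=
  TensorialAt.mkHom₂ (I := I) (F := E) (F' := E) (fun X Y => α.extDerivAux X Y x) x
    (fun Y _ => α.extDerivAux_tensorial₁ Y) (fun X _ => α.extDerivAux_tensorial₂ X)

theorem extDeriv_apply (α : SmoothOneForm I M) {X Y : Π x : M, TangentSpace I x} {x : M}
    (hX : MDiffAt (T% X) x) (hY : MDiffAt (T% Y) x) :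
    α.extDeriv x (X x) (Y x) = (1 / 2) * (mvfderiv I (fun y => α y (Y y)) x (X x)
      - mvfderiv I (fun y => α y (X y)) x (Y x) - α x (mlieBracket I X Y x)) :=
  TensorialAt.mkHom₂_apply (I := I) (F := E) (F' := E)
    (fun Y _ => α.extDerivAux_tensorial₁ Y) (fun X _ => α.extDerivAux_tensorial₂ X) hX hY

theorem extDeriv_self (α : SmoothOneForm I M) (x : M) (v : TangentSpace I x) :
    α.extDeriv x v v = 0 := by
  have h := α.extDerivAux_swap (FiberBundle.extend E v) (FiberBundle.extend E v) x
  have h' : α.extDeriv x v v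
      = α.extDerivAux (FiberBundle.extend E v) (FiberBundle.extend E v) x := rfl
  linarith

/-- `α` at `x`, as an alternating form of degree 1. -/
def form (α : SmoothOneForm I M) (x : M) : TangentSpace I x [⋀^Fin 1]→ₗ[ℝ] ℝ :=
  formOne (α x : TangentSpace I x →ₗ[ℝ] ℝ)

/-- `dα` at `x`, as an alternating form of degree 2. -/
def dForm (α : SmoothOneForm I M) (x : M) : TangentSpace I x [⋀^Fin 2]→ₗ[ℝ] ℝ :=
  formTwo ((ContinuousLinearMap.coeLM ℝ).comp (α.extDeriv x : TangentSpace I x →ₗ[ℝ] _))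
    (α.extDeriv_self x)

end SmoothOneForm

end Forms

/-! ### Contact pairs -/

section ContactPair

variable {E : Type*} [NormedAddCommGroup E] [NormedSpace ℝ E] [FiniteDimensional ℝ E]
  {H : Type*} [TopologicalSpace H] {I : ModelWithCorners ℝ E H}
  {M : Type*} [TopologicalSpace M] [ChartedSpace H M] [IsManifold I ∞ M]

/-- `(α₁, α₂)` is a contact pair of type `(p, q)`: `α₁ ∧ (dα₁)^p ∧ α₂ ∧ (dα₂)^q` vanishes nowhere,
`(dα₁)^(p+1) = 0` and `(dα₂)^(q+1) = 0`. The dimension `2p + 2q + 2` of the manifold is not part of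
this definition. -/
structure IsContactPair (p q : ℕ) (α₁ α₂ : SmoothOneForm I M) : Prop where
  volume : ∀ x, wedge (wedge (α₁.form x) (wedgePow (α₁.dForm x) p))
    (wedge (α₂.form x) (wedgePow (α₂.dForm x) q)) ≠ 0
  pow₁ : ∀ x, wedgePow (α₁.dForm x) (p + 1) = 0
  pow₂ : ∀ x, wedgePow (α₂.dForm x) (q + 1) = 0

/-- `Z₁`, `Z₂` are the Reeb vector fields of the contact pair `(α₁, α₂)`. -/
structure IsReebPair (α₁ α₂ : SmoothOneForm I M) (Z₁ Z₂ : SmoothVectorField I M) : Prop where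
  apply₁₁ : ∀ x, α₁ x (Z₁ x) = 1
  apply₂₂ : ∀ x, α₂ x (Z₂ x) = 1
  apply₁₂ : ∀ x, α₁ x (Z₂ x) = 0
  apply₂₁ : ∀ x, α₂ x (Z₁ x) = 0
  contract₁₁ : ∀ x, α₁.extDeriv x (Z₁ x) = 0
  contract₁₂ : ∀ x, α₂.extDeriv x (Z₁ x) = 0
  contract₂₁ : ∀ x, α₁.extDeriv x (Z₂ x) = 0
  contract₂₂ : ∀ x, α₂.extDeriv x (Z₂ x) = 0

/-- The tangent space at `x` of the characteristic foliation of `α`: `ker α ∩ ker dα`. -/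
def characteristicSpace (α : SmoothOneForm I M) (x : M) : Set (TangentSpace I x) :=
  {v | α x v = 0 ∧ α.extDeriv x v = 0}

variable [RiemannianBundle (fun x : M => TangentSpace I x)]
  [IsContMDiffRiemannianBundle I ∞ E (fun x : M => TangentSpace I x)]

variable (I M) in
/-- A metric contact pair structure `(α₁, α₂, Z₁, Z₂, φ, g)` of type `(p, q)` with decomposable `φ`
on the Riemannian manifold `M`, whose metric `g` is the one carried by the tangent bundle. -/
structure MetricContactPair (p q : ℕ) where
  /-- The 1-forms of the contact pair. -/
  α₁ : SmoothOneForm I M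
  α₂ : SmoothOneForm I M
  /-- The Reeb vector fields. -/
  Z₁ : SmoothVectorField I M
  Z₂ : SmoothVectorField I M
  /-- The structure endomorphism. -/
  φ : SmoothEndField I M
  isContactPair : IsContactPair p q α₁ α₂
  isReebPair : IsReebPair α₁ α₂ Z₁ Z₂
  φ_sq : ∀ x (v : TangentSpace I x), φ x (φ x v) = -v + α₁ x v • Z₁ x + α₂ x v • Z₂ x
  φ_Z₁ : ∀ x, φ x (Z₁ x) = 0
  φ_Z₂ : ∀ x, φ x (Z₂ x) = 0
  /-- `φ` is decomposable: it preserves the two characteristic foliations. -/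
  decomposable₁ : ∀ x, ∀ v ∈ characteristicSpace α₁ x, φ x v ∈ characteristicSpace α₁ x
  decomposable₂ : ∀ x, ∀ v ∈ characteristicSpace α₂ x, φ x v ∈ characteristicSpace α₂ x
  /-- The metric is compatible with, and associated to, the almost contact pair structure. -/
  compatible : ∀ x (v w : TangentSpace I x),
    inner ℝ (φ x v) (φ x w) = inner ℝ v w - α₁ x v * α₁ x w - α₂ x v * α₂ x w
  associated : ∀ x (v w : TangentSpace I x),
    inner ℝ v (φ x w) = α₁.extDeriv x v w + α₂.extDeriv x v w
  inner_Z₁ : ∀ x (v : TangentSpace I x), inner ℝ v (Z₁ x) = α₁ x v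
  inner_Z₂ : ∀ x (v : TangentSpace I x), inner ℝ v (Z₂ x) = α₂ x v

/-- An almost complex structure `J` is integrable: its Nijenhuis tensor
`[JX, JY] - J[JX, Y] - J[X, JY] + J²[X, Y]` vanishes. -/
def IsIntegrable (J : Π x : M, TangentSpace I x →L[ℝ] TangentSpace I x) : Prop :=
  ∀ X Y : Π x : M, TangentSpace I x, CMDiff ∞ (T% X) → CMDiff ∞ (T% Y) → ∀ x,
    mlieBracket I (fun y => J y (X y)) (fun y => J y (Y y)) x
      - J x (mlieBracket I (fun y => J y (X y)) Y x)
      - J x (mlieBracket I X (fun y => J y (Y y)) x)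
      + J x (J x (mlieBracket I X Y x)) = 0

namespace MetricContactPair

variable {p q : ℕ} (S : MetricContactPair I M p q)

/-- `J = φ - α₂ ⊗ Z₁ + α₁ ⊗ Z₂`. -/
def J (x : M) : TangentSpace I x →L[ℝ] TangentSpace I x :=
  S.φ x - (S.α₂ x).smulRight (S.Z₁ x) + (S.α₁ x).smulRight (S.Z₂ x)

/-- `T = φ + α₂ ⊗ Z₁ - α₁ ⊗ Z₂`. -/
def T (x : M) : TangentSpace I x →L[ℝ] TangentSpace I x :=
  S.φ x + (S.α₂ x).smulRight (S.Z₁ x) - (S.α₁ x).smulRight (S.Z₂ x)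

/-- The metric contact pair is normal: `J` and `T` are both integrable. -/
def IsNormal : Prop := IsIntegrable S.J ∧ IsIntegrable S.T

/-- The Ricci tensor is `lam g + β α₁ ⊗ α₁ + μ α₂ ⊗ α₂`. -/
def HasQuasiEinsteinRicci (lam β μ : M → ℝ) : Prop :=
  ∀ x (v w : TangentSpace I x), ricci I x v w
    = lam x * inner ℝ v w + β x * (S.α₁ x v * S.α₁ x w) + μ x * (S.α₂ x v * S.α₂ x w)

end MetricContactPair

end ContactPair

end ContactPairs

end

/-!
Normality plays no role: the obstruction is visible on the horizontal distribution
`ker α₁ ∩ ker α₂` alone.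

Let `X`, `Y` be horizontal vector fields. The quasi-Einstein condition gives
`Ric(·, Z₁) = (λ + β) α₁` and `Ric(X, ·) = λ g(X, ·)`. The function `Ric(Y, Z₁)` vanishes
identically, so that no derivative of `λ` or `β` appears in `(∇_X Ric)(Y, Z₁)`, and with
`g(∇_X Y, Z₁) = - g(Y, ∇_X Z₁)` one finds `(∇_X Ric)(Y, Z₁) = - β g(∇_X Y, Z₁)`. Antisymmetrizing
in `X` and `Y`, the connection being torsion free, the Codazzi equation becomes
`β α₁([X, Y]) = 0`, that is, `β dα₁(X, Y) = 0` (`ContactPairs.RicciIsCodazzi.mul_extDeriv_eq_zero`).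

Since `p ≥ 1`, the volume condition forces `dα₁ ≠ 0` at every point, and since the Reeb fields are
in the kernel of `dα₁`, it is already nonzero on a pair of horizontal vectors. These extend to
global horizontal fields (`ContactPairs.MetricContactPair.exists_horizontal`), hence `β = 0`
everywhere. In the same way `q ≥ 1` gives `μ = 0`, so `β` and `μ` both vanish identically.
-/

open Bundle VectorField
open scoped Manifold ContDiff

namespace ContactPairs

/-! ### Global extensions of tangent vectors -/

section Extension

variable {E : Type*} [NormedAddCommGroup E] [NormedSpace ℝ E] [FiniteDimensional ℝ E]
  {H : Type*} [TopologicalSpace H] {I : ModelWithCorners ℝ E H}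
  {M : Type*} [TopologicalSpace M] [ChartedSpace H M] [IsManifold I ∞ M]

/-- Every tangent vector is the value of a globally smooth vector field. -/
theorem exists_smooth_extension [T2Space M] {x : M} (v : TangentSpace I x) :
    ∃ X : Π y : M, TangentSpace I y, CMDiff ∞ (T% X) ∧ X x = v := by
  obtain ⟨s, hs, hsm⟩ := FiberBundle.exists_contMDiffOn_extend (k := ∞) I E v
  obtain ⟨u, hus, hu, hxu⟩ := mem_nhds_iff.1 hs
  obtain ⟨f, -, hf⟩ :=
    (SmoothBumpFunction.nhds_basis_tsupport (I := I) x).mem_iff.1 (hu.mem_nhds hxu)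
  refine ⟨(f : M → ℝ) • FiberBundle.extend E v,
    ContMDiffOn.smul_section_of_tsupport f.contMDiff.contMDiffOn hu hf (hsm.mono hus), ?_⟩
  simp

theorem SmoothOneForm.contMDiff_apply (α : SmoothOneForm I M) {X : Π x : M, TangentSpace I x}
    (hX : CMDiff ∞ (T% X)) : CMDiff ∞ (fun y => α y (X y)) := by
  intro x
  have h : ContMDiffAt I (I.prod 𝓘(ℝ)) ∞
      (fun y => TotalSpace.mk' ℝ (E := Bundle.Trivial M ℝ) y (α y (X y))) x := by
    apply ContMDiffAt.clm_bundle_apply (F₁ := E) (F₂ := ℝ) (b := fun y : M => y)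
      (E₁ := fun y : M => TangentSpace I y) (E₂ := Bundle.Trivial M ℝ)
    · exact α.smooth x
    · exact hX x
  simpa [contMDiffAt_section] using h

end Extension

/-! ### Wedge products with zero -/

section Exterior

variable {V : Type*} [AddCommGroup V] [Module ℝ V]

theorem wedge_zero_left {k l : ℕ} (b : V [⋀^Fin l]→ₗ[ℝ] ℝ) :
    wedge (0 : V [⋀^Fin k]→ₗ[ℝ] ℝ) b = 0 := by
  have h : (0 : V [⋀^Fin k]→ₗ[ℝ] ℝ).domCoprod b = 0 := by
    rw [← AlternatingMap.domCoprod'_apply, TensorProduct.zero_tmul, map_zero]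
  rw [wedge, h]
  ext
  simp

theorem wedge_zero_right {k l : ℕ} (a : V [⋀^Fin k]→ₗ[ℝ] ℝ) :
    wedge a (0 : V [⋀^Fin l]→ₗ[ℝ] ℝ) = 0 := by
  have h : a.domCoprod (0 : V [⋀^Fin l]→ₗ[ℝ] ℝ) = 0 := by
    rw [← AlternatingMap.domCoprod'_apply, TensorProduct.tmul_zero, map_zero]
  rw [wedge, h]
  ext
  simp

theorem wedgePow_zero {n : ℕ} (hn : 0 < n) : wedgePow (0 : V [⋀^Fin 2]→ₗ[ℝ] ℝ) n = 0 := by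
  obtain ⟨m, rfl⟩ := Nat.exists_eq_succ_of_ne_zero hn.ne'
  exact wedge_zero_right _

end Exterior

/-! ### Nondegeneracy of the contact pair -/

section ContactPair

variable {E : Type*} [NormedAddCommGroup E] [NormedSpace ℝ E] [FiniteDimensional ℝ E]
  {H : Type*} [TopologicalSpace H] {I : ModelWithCorners ℝ E H}
  {M : Type*} [TopologicalSpace M] [ChartedSpace H M] [IsManifold I ∞ M]

theorem SmoothOneForm.dForm_eq_zero {α : SmoothOneForm I M} {x : M}
    (h : ∀ v w, α.extDeriv x v w = 0) : α.dForm x = 0 := by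
  ext v
  exact h (v 0) (v 1)

theorem IsContactPair.exists_extDeriv_ne_zero₁ {p q : ℕ} {α₁ α₂ : SmoothOneForm I M}
    (h : IsContactPair p q α₁ α₂) (hp : 0 < p) (x : M) : ∃ v w, α₁.extDeriv x v w ≠ 0 := by
  by_contra! h0
  apply h.volume x
  rw [SmoothOneForm.dForm_eq_zero h0, wedgePow_zero hp, wedge_zero_right, wedge_zero_left]

theorem IsContactPair.exists_extDeriv_ne_zero₂ {p q : ℕ} {α₁ α₂ : SmoothOneForm I M}
    (h : IsContactPair p q α₁ α₂) (hq : 0 < q) (x : M) : ∃ v w, α₂.extDeriv x v w ≠ 0 := by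
  by_contra! h0
  apply h.volume x
  rw [SmoothOneForm.dForm_eq_zero h0, wedgePow_zero hq, wedge_zero_right, wedge_zero_right]

theorem SmoothOneForm.extDeriv_swap (α : SmoothOneForm I M) (x : M) (v w : TangentSpace I x) :
    α.extDeriv x v w = -α.extDeriv x w v := by
  have h := α.extDeriv_self x (v + w)
  simp only [map_add, _root_.add_apply, α.extDeriv_self] at h
  linarith

/-- Adding multiples of vectors in the kernel of `dα` does not change `dα(v, w)`. -/
theorem SmoothOneForm.extDeriv_sub_smul (α : SmoothOneForm I M) {x : M} {z₁ z₂ : TangentSpace I x}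
    (h₁ : α.extDeriv x z₁ = 0) (h₂ : α.extDeriv x z₂ = 0) (v w : TangentSpace I x)
    (a b c d : ℝ) :
    α.extDeriv x (v - a • z₁ - b • z₂) (w - c • z₁ - d • z₂) = α.extDeriv x v w := by
  have e₁ : α.extDeriv x v z₁ = 0 := by rw [α.extDeriv_swap, h₁]; simp
  have e₂ : α.extDeriv x v z₂ = 0 := by rw [α.extDeriv_swap, h₂]; simp
  simp [h₁, h₂, e₁, e₂]

end ContactPair

/-! ### The Codazzi equation on horizontal vector fields -/

section Codazzi

variable {E : Type*} [NormedAddCommGroup E] [NormedSpace ℝ E] [FiniteDimensional ℝ E]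
  {H : Type*} [TopologicalSpace H] {I : ModelWithCorners ℝ E H}
  {M : Type*} [TopologicalSpace M] [ChartedSpace H M] [IsManifold I ∞ M]
  [RiemannianBundle (fun x : M => TangentSpace I x)]
  [IsContMDiffRiemannianBundle I ∞ E (fun x : M => TangentSpace I x)]

/-- If `Z` is the metric dual of `α`, `Ric(·, Z) = c α`, and `Y ∈ ker α` satisfies
`Ric(Y, ·) = l g(Y, ·)` at `x`, then `(∇_X Ric)(Y, Z) = (l - c) α(∇_X Y)` at `x`. Neither `c` nor
`l` is differentiated. -/
theorem nablaRicci_of_eigenvector {α : SmoothOneForm I M} {Z : SmoothVectorField I M}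
    (hZ : ∀ x (v : TangentSpace I x), inner ℝ v (Z x) = α x v) {c : M → ℝ}
    (hc : ∀ x (v : TangentSpace I x), ricci I x v (Z x) = c x * α x v)
    {X Y : Π x : M, TangentSpace I x} (hX : CMDiff ∞ (T% X)) (hY : CMDiff ∞ (T% Y))
    (hαY : ∀ y, α y (Y y) = 0) {x : M} {l : ℝ}
    (hl : ∀ w : TangentSpace I x, ricci I x (Y x) w = l * inner ℝ (Y x) w) :
    nablaRicci I X Y Z x = (l - c x) * α x (nabla I X Y x) := by
  have h0 : mvfderiv I (fun _ : M => (0 : ℝ)) x (X x) = 0 := by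
    rw [mvfderiv_const]; rfl
  have hm := leviCivita_metric ((hX x).mdifferentiableAt (by simp))
    ((hY x).mdifferentiableAt (by simp)) ((Z.smooth x).mdifferentiableAt (by simp))
  have hf : (fun y => inner ℝ (Y y) (Z y)) = fun _ : M => (0 : ℝ) := by
    ext y; rw [hZ, hαY]
  have hr : (fun y => ricci I y (Y y) (Z y)) = fun _ : M => (0 : ℝ) := by
    ext y; rw [hc, hαY, mul_zero]
  rw [hf, h0, hZ] at hm
  rw [nablaRicci, hr, h0, hc, hl]
  simp only [nabla]
  linear_combination l * hm

/-- The Codazzi equation for `X, Y ∈ ker α` and the metric dual `Z` of `α`, when `Z` is a Ricci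
eigenvector field with eigenvalue `c`, and `X`, `Y` are Ricci eigenvectors with eigenvalue `l`
at `x`. -/
theorem RicciIsCodazzi.mul_extDeriv_eq_zero (hcod : RicciIsCodazzi I M)
    {α : SmoothOneForm I M} {Z : SmoothVectorField I M}
    (hZ : ∀ x (v : TangentSpace I x), inner ℝ v (Z x) = α x v) {c : M → ℝ}
    (hc : ∀ x (v : TangentSpace I x), ricci I x v (Z x) = c x * α x v)
    {X Y : Π x : M, TangentSpace I x} (hX : CMDiff ∞ (T% X)) (hY : CMDiff ∞ (T% Y))
    (hαX : ∀ y, α y (X y) = 0) (hαY : ∀ y, α y (Y y) = 0) {x : M} {l : ℝ}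
    (hlX : ∀ w : TangentSpace I x, ricci I x (X x) w = l * inner ℝ (X x) w)
    (hlY : ∀ w : TangentSpace I x, ricci I x (Y x) w = l * inner ℝ (Y x) w) :
    (c x - l) * α.extDeriv x (X x) (Y x) = 0 := by
  have hXd := (hX x).mdifferentiableAt (by simp)
  have hYd := (hY x).mdifferentiableAt (by simp)
  have h := hcod X Y Z hX hY Z.smooth x
  rw [nablaRicci_of_eigenvector hZ hc hX hY hαY hlY,
    nablaRicci_of_eigenvector hZ hc hY hX hαX hlX] at h
  have ht : α x (nabla I X Y x) - α x (nabla I Y X x) = α x (mlieBracket I X Y x) := by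
    rw [← map_sub]
    exact congrArg (α x) (leviCivita_torsion hXd hYd)
  have hd : α.extDeriv x (X x) (Y x) = -(1 / 2) * α x (mlieBracket I X Y x) := by
    rw [α.extDeriv_apply hXd hYd, funext hαX, funext hαY, mvfderiv_const]
    simp
  rw [hd]
  linear_combination (1 / 2) * h - (1 / 2) * (l - c x) * ht

namespace MetricContactPair

variable {p q : ℕ} (S : MetricContactPair I M p q)

/-- The horizontal part of a tangent vector is the value of a smooth vector field that is
horizontal everywhere. -/
theorem exists_horizontal [T2Space M] {x : M} (v : TangentSpace I x) :
    ∃ X : Π y : M, TangentSpace I y, CMDiff ∞ (T% X) ∧ (∀ y, S.α₁ y (X y) = 0) ∧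
      (∀ y, S.α₂ y (X y) = 0) ∧ X x = v - S.α₁ x v • S.Z₁ x - S.α₂ x v • S.Z₂ x := by
  obtain ⟨V, hV, rfl⟩ := exists_smooth_extension v
  refine ⟨V - (fun y => S.α₁ y (V y)) • S.Z₁.toFun - (fun y => S.α₂ y (V y)) • S.Z₂.toFun,
    (hV.sub_section ((S.α₁.contMDiff_apply hV).smul_section S.Z₁.smooth)).sub_section
      ((S.α₂.contMDiff_apply hV).smul_section S.Z₂.smooth), fun y => ?_, fun y => ?_, rfl⟩
  · simp [S.isReebPair.apply₁₁, S.isReebPair.apply₁₂]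
  · simp [S.isReebPair.apply₂₁, S.isReebPair.apply₂₂]

variable {S} {lam β μ : M → ℝ}

theorem HasQuasiEinsteinRicci.ricci_Z₁ (h : S.HasQuasiEinsteinRicci lam β μ) (x : M)
    (v : TangentSpace I x) : ricci I x v (S.Z₁ x) = (lam x + β x) * S.α₁ x v := by
  rw [h, S.inner_Z₁, S.isReebPair.apply₁₁, S.isReebPair.apply₂₁]
  ring

theorem HasQuasiEinsteinRicci.ricci_Z₂ (h : S.HasQuasiEinsteinRicci lam β μ) (x : M)
    (v : TangentSpace I x) : ricci I x v (S.Z₂ x) = (lam x + μ x) * S.α₂ x v := by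
  rw [h, S.inner_Z₂, S.isReebPair.apply₁₂, S.isReebPair.apply₂₂]
  ring

theorem HasQuasiEinsteinRicci.ricci_horizontal (h : S.HasQuasiEinsteinRicci lam β μ) {x : M}
    {v : TangentSpace I x} (h₁ : S.α₁ x v = 0) (h₂ : S.α₂ x v = 0) (w : TangentSpace I x) :
    ricci I x v w = lam x * inner ℝ v w := by
  rw [h, h₁, h₂]
  ring

/-- Once `dα(v, w) ≠ 0` for some `v`, `w`, the Codazzi equation forces the Ricci eigenvalue `c` of
the dual of `α` to equal that of the horizontal vectors. Here `α` is `α₁` or `α₂`. -/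
theorem HasQuasiEinsteinRicci.eigenvalue_eq [T2Space M] (h : S.HasQuasiEinsteinRicci lam β μ)
    (hcod : RicciIsCodazzi I M) {α : SmoothOneForm I M} {Z : SmoothVectorField I M}
    (hα : α = S.α₁ ∨ α = S.α₂)
    (hZ : ∀ x (v : TangentSpace I x), inner ℝ v (Z x) = α x v) {c : M → ℝ}
    (hc : ∀ x (v : TangentSpace I x), ricci I x v (Z x) = c x * α x v)
    {x : M} (hd : ∃ v w, α.extDeriv x v w ≠ 0) : c x = lam x := by
  obtain ⟨v, w, hvw⟩ := hd
  obtain ⟨X, hX, hX₁, hX₂, hXv⟩ := S.exists_horizontal v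
  obtain ⟨Y, hY, hY₁, hY₂, hYw⟩ := S.exists_horizontal w
  have hZ₁ : α.extDeriv x (S.Z₁ x) = 0 := by
    rcases hα with rfl | rfl
    exacts [S.isReebPair.contract₁₁ x, S.isReebPair.contract₁₂ x]
  have hZ₂ : α.extDeriv x (S.Z₂ x) = 0 := by
    rcases hα with rfl | rfl
    exacts [S.isReebPair.contract₂₁ x, S.isReebPair.contract₂₂ x]
  have key := hcod.mul_extDeriv_eq_zero hZ hc hX hY
    (by rcases hα with rfl | rfl <;> assumption) (by rcases hα with rfl | rfl <;> assumption)
    (h.ricci_horizontal (hX₁ x) (hX₂ x)) (h.ricci_horizontal (hY₁ x) (hY₂ x))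
  rw [hXv, hYw, α.extDeriv_sub_smul hZ₁ hZ₂] at key
  exact sub_eq_zero.1 ((mul_eq_zero.1 key).resolve_right hvw)

end MetricContactPair

end Codazzi

end ContactPairs

theorem theorem5p2 (p q : ℕ) (hp : 0 < p) (hq : 0 < q)
    {M : Type*} [TopologicalSpace M] [T2Space M] [SecondCountableTopology M]
    [ChartedSpace (EuclideanSpace ℝ (Fin (2 * p + 2 * q + 2))) M]
    [IsManifold (𝓡 (2 * p + 2 * q + 2)) ∞ M]
    [RiemannianBundle (fun x : M => TangentSpace (𝓡 (2 * p + 2 * q + 2)) x)]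
    [IsContMDiffRiemannianBundle (𝓡 (2 * p + 2 * q + 2)) ∞
      (EuclideanSpace ℝ (Fin (2 * p + 2 * q + 2)))
      (fun x : M => TangentSpace (𝓡 (2 * p + 2 * q + 2)) x)]
    (S : ContactPairs.MetricContactPair (𝓡 (2 * p + 2 * q + 2)) M p q) (hS : S.IsNormal)
    (lam β μ : M → ℝ) (hRic : S.HasQuasiEinsteinRicci lam β μ)
    (hne : (∃ x, β x ≠ 0) ∨ (∃ x, μ x ≠ 0)) :
    ¬ ContactPairs.RicciIsCodazzi (𝓡 (2 * p + 2 * q + 2)) M := by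

  intro hcod
  rcases hne with ⟨x, hx⟩ | ⟨x, hx⟩
  · have := hRic.eigenvalue_eq hcod (.inl rfl) S.inner_Z₁ (c := fun x => lam x + β x)
      hRic.ricci_Z₁ (S.isContactPair.exists_extDeriv_ne_zero₁ hp x)
    exact hx (by linarith)
  · have := hRic.eigenvalue_eq hcod (.inr rfl) S.inner_Z₂ (c := fun x => lam x + μ x)
      hRic.ricci_Z₂ (S.isContactPair.exists_extDeriv_ne_zero₂ hq x)
    exact hx (by linarith)
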